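/- Let $A\subseteq\mathbb{R}^2$ be a finite set of at least three points that is generic, i.e. no three points are collinear and no four are cocircular. A triangulation of $A$ is an edge-to-edge subdivision of $\operatorname{conv}A$ into triangles with vertices in $A$; it is complete if every point of $A$ is a vertex of at least one of its triangles. The Delaunay triangulation $\operatorname{Del}(A)$ consists of all triangles with vertices in $A$ whose circumcircle encloses no point of $A$. For a complete triangulation $P$ of $A$ and $x\in A$, let $\operatorname{st}(P,x)$ be the union of the triangles of $P$ that have $x$ as a vertex, and let $\operatorname{wh}(P,x)=\operatorname{st}(P,x)\cap\operatorname{conv}(A\setminus\{x\})$ be the white region of $x$. The constrained Delaunay triangulation of $\operatorname{wh}(P,x)$ is the edge-to-edge subdivision of this polygonal region (more precisely, of the closure of its interior) into triangles spanned by its vertices such that, for every edge shared by two of the triangles, the two angles opposite to the edge add up to at most $\pi$. Let $f(P)$ be the collection of all triangles of $P$ together with all triangles of the constrained Delaunay triangulations of the white regions $\operatorname{wh}(P,x)$, $x\in A$. (Up to similarity of each triangle, $f(P)$ is the complete level-2 hypertriangulation aged from $P$, with white regions decomposed by constrained Delaunay triangulations, and $f(\operatorname{Del}(A))$ is the order-2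 Delaunay triangulation of $A$.) Then, for every complete triangulation $P$ of $A$, the minimum angle of the triangles in $f(P)$ is smaller than or equal to the minimum angle of the triangles in $f(\operatorname{Del}(A))$. -/

import Mathlib

namespace HyperTri

/-- The Euclidean plane. -/
abbrev Plane : Type := EuclideanSpace ℝ (Fin 2)

/-- A finite planar set is generic if no three of its points are collinear and no four of its
points are cocircular. -/
def IsGeneric (A : Finset Plane) : Prop :=
  (∀ B : Finset Plane, B ⊆ A → B.card = 3 → ¬ Collinear ℝ (B : Set Plane)) ∧
  (∀ B : Finset Plane, B ⊆ A → B.card = 4 → ¬ EuclideanGeometry.Cospherical (B : Set Plane))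

/-- `C` is an edge-to-edge subdivision of the set `R` into (non-degenerate) triangles whose vertices
belong to `V`. A triangle is given by its set of three vertices. Edge-to-edge means that any two
triangles intersect in the face spanned by their common vertices (empty, a vertex or an edge). -/
structure IsSubdivision (R V : Set Plane) (C : Set (Finset Plane)) : Prop where
  vertices : ∀ T ∈ C, (T : Set Plane) ⊆ V
  card_eq_three : ∀ T ∈ C, T.card = 3
  not_collinear : ∀ T ∈ C, ¬ Collinear ℝ (T : Set Plane)
  cover : (⋃ T ∈ C, convexHull ℝ (T : Set Plane)) = R
  edge_to_edge : ∀ T ∈ C, ∀ T' ∈ C,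
    convexHull ℝ (T : Set Plane) ∩ convexHull ℝ (T' : Set Plane)
      = convexHull ℝ ((T : Set Plane) ∩ (T' : Set Plane))

/-- A (possibly partial) triangulation of the finite set `A`. -/
def IsTriangulation (A : Finset Plane) (P : Set (Finset Plane)) : Prop :=
  IsSubdivision (convexHull ℝ (A : Set Plane)) (A : Set Plane) P

/-- A complete triangulation of `A`: every point of `A` is a vertex of at least one triangle. -/
def IsCompleteTriangulation (A : Finset Plane) (P : Set (Finset Plane)) : Prop :=
  IsTriangulation A P ∧ ∀ a ∈ A, ∃ T ∈ P, a ∈ T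

/-- The Delaunay triangulation of `A`: all triangles with vertices in `A` whose circumcircle
encloses no point of `A`. -/
def delaunay (A : Finset Plane) : Set (Finset Plane) :=
  {T | T ⊆ A ∧ T.card = 3 ∧ ∃ s : EuclideanGeometry.Sphere Plane,
    (∀ p ∈ T, p ∈ s) ∧ ∀ p ∈ A, ¬ dist p s.center < s.radius}

/-- The star of `x` in `P`: the union of the triangles of `P` that have `x` as a vertex. -/
def star (P : Set (Finset Plane)) (x : Plane) : Set Plane :=
  ⋃ T ∈ {T | T ∈ P ∧ x ∈ T}, convexHull ℝ (T : Set Plane)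

/-- The vertices of `P` that are connected to `x` by an edge of `P`. -/
def neighbors (P : Set (Finset Plane)) (x : Plane) : Set Plane :=
  {v | v ≠ x ∧ ∃ T ∈ P, x ∈ T ∧ v ∈ T}

/-- The white region of `x` in `P`: the part of the star of `x` in the convex hull of
`A \ {x}`. -/
def whiteRegion (A : Finset Plane) (P : Set (Finset Plane)) (x : Plane) : Set Plane :=
  star P x ∩ convexHull ℝ ((A : Set Plane) \ {x})

/-- For every edge `uv` shared by two triangles of `C`, the two angles opposite to the edge add up
to at most `π`. -/
def LocallyDelaunay (C : Set (Finset Plane)) : Prop :=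
  ∀ T ∈ C, ∀ T' ∈ C, ∀ u v w w' : Plane, u ≠ v →
    u ∈ T → v ∈ T → u ∈ T' → v ∈ T' → w ∈ T → w ∉ T' → w' ∈ T' → w' ∉ T →
    EuclideanGeometry.angle u w v + EuclideanGeometry.angle u w' v ≤ Real.pi

/-- `C` is the constrained Delaunay triangulation of the polygonal region `R` with vertex set `V`:
a subdivision of `R` into triangles spanned by `V` in which each edge that passes through the
interior of `R` is locally Delaunay. One-dimensional parts of `R`, which no triangle can cover, are
discarded by taking the closure of the interior. -/
def IsConstrainedDelaunay (R V : Set Plane) (C : Set (Finset Plane)) : Prop :=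
  IsSubdivision (closure (interior R)) V C ∧ LocallyDelaunay C

/-- `Φ = f(P)`: the collection `Φ` consists of the (black) triangles of `P` together with the
(white) triangles of the constrained Delaunay triangulations of the white regions of all `x ∈ A`.
The vertices of the white region of `x` are neighbors of `x` in `P`; a neighbor of `x` that is not
one of them lies outside the closure of the interior of the white region, so that it is not
a vertex of a white triangle. -/
def IsAged (A : Finset Plane) (P Φ : Set (Finset Plane)) : Prop :=
  ∃ W : Plane → Set (Finset Plane),
    (∀ x ∈ A, IsConstrainedDelaunay (whiteRegion A P x) (neighbors P x) (W x)) ∧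
    Φ = P ∪ ⋃ x ∈ A, W x

/-- The set of all angles of the triangles in `Φ`. -/
def angles (Φ : Set (Finset Plane)) : Set ℝ :=
  {θ | ∃ T ∈ Φ, ∃ a ∈ T, ∃ b ∈ T, ∃ c ∈ T, a ≠ b ∧ b ≠ c ∧ a ≠ c ∧
    θ = EuclideanGeometry.angle a b c}

end HyperTri

/-! Fix the angle at w in a triangle uvw of f(Del(A)). Its circumcircle encloses at most one point
of A: none if the triangle is black, and only x if it is a white triangle of x (`eq_of_pow_neg`). In
P, take the triangle upq that contains the start of the edge uv at u, on the side of w. Then p lies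
on that side, and q = v or pq crosses uv, so angle upq ≤ angle upv. If p is not inside the circle,
angle upv ≤ angle uwv by the inscribed angle theorem. If p is inside, it is the only such point. The
white triangles of p cover the same start of uv, and the one found there has an apex p' ≠ p, hence
not inside the circle (`exists_angle_le`).

That white circumcircles of Del(A) enclose no point other than x (`pow_nonneg_of_white`) is a
descent: if a is enclosed, crossing an edge that separates the triangle from a leads to a white
triangle with smaller power of a, by the local Delaunay condition. The crossing cannot leave the
white region, since Delaunay circles are empty and Delaunay triangles do not overlap.

All comparisons use the pencil of circles through u and v, parametrized by the cotangent `dotAt /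
orient` of the inscribed angle. Of P itself, only `IsPureCover` is used. -/

namespace HyperTri

open Filter Topology

/-! ### Signed areas, powers of points and genericity -/

/-- Twice the signed area of the triangle `abc`. -/
def orient (a b c : Plane) : ℝ :=
  (b 0 - a 0) * (c 1 - a 1) - (b 1 - a 1) * (c 0 - a 0)

/-- The inner product of `u - y` and `v - y`. -/
def dotAt (u v y : Plane) : ℝ :=
  (u 0 - y 0) * (v 0 - y 0) + (u 1 - y 1) * (v 1 - y 1)

/-- The power of `y` with respect to the circle through `u`, `v` and `w`. -/
noncomputable def pow (u v w y : Plane) : ℝ :=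
  dotAt u v y - dotAt u v w / orient u v w * orient u v y

theorem plane_ext {a b : Plane} (h0 : a 0 = b 0) (h1 : a 1 = b 1) : a = b := by
  ext i
  fin_cases i
  · exact h0
  · exact h1

theorem orient_rotate (a b c : Plane) : orient b c a = orient a b c := by
  unfold orient; ring

theorem orient_swap (a b c : Plane) : orient b a c = -orient a b c := by
  unfold orient; ring

@[simp] theorem orient_self_left (a b : Plane) : orient a a b = 0 := by
  unfold orient; ring

@[simp] theorem orient_self_right (a b : Plane) : orient a b b = 0 := by
  unfold orient; ring

@[simp] theorem orient_self_outer (a b : Plane) : orient a b a = 0 := by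
  unfold orient; ring

theorem dotAt_comm (u v y : Plane) : dotAt v u y = dotAt u v y := by
  unfold dotAt; ring

theorem orient_combo (a b x y : Plane) {s t : ℝ} (h : s + t = 1) :
    orient a b (s • x + t • y) = s * orient a b x + t * orient a b y := by
  obtain rfl : t = 1 - s := by linarith
  simp only [orient, PiLp.add_apply, PiLp.smul_apply, smul_eq_mul]
  ring

theorem continuous_orient (a b : Plane) : Continuous fun z => orient a b z := by
  unfold orient; fun_prop

theorem convex_orient_nonneg (a b : Plane) : Convex ℝ {z | 0 ≤ orient a b z} := by
  intro x hx y hy s t hs ht hst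
  simp only [Set.mem_ofPred_eq] at hx hy ⊢
  rw [orient_combo _ _ _ _ hst]
  positivity

theorem triangle_combo {a b c z : Plane} (h : orient a b c ≠ 0) :
    z = (orient b c z / orient a b c) • a + (orient c a z / orient a b c) • b +
        (orient a b z / orient a b c) • c := by
  apply plane_ext <;>
  · simp only [PiLp.add_apply, PiLp.smul_apply, smul_eq_mul]
    field_simp
    unfold orient; ring

theorem combo_mem_hull {a b c : Plane} {r s t : ℝ} (hr : 0 ≤ r) (hs : 0 ≤ s) (ht : 0 ≤ t)
    (h : r + s + t = 1) : r • a + s • b + t • c ∈ convexHull ℝ ({a, b, c} : Set Plane) := by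
  have := (convex_convexHull ℝ ({a, b, c} : Set Plane)).sum_mem (t := Finset.univ)
    (w := ![r, s, t]) (z := ![a, b, c]) ?_ ?_ ?_
  · simpa [Fin.sum_univ_three] using this
  · intro i _
    fin_cases i <;> simpa
  · simpa [Fin.sum_univ_three]
  · intro i _
    apply subset_convexHull ℝ
    fin_cases i <;> simp

theorem mem_triangle_iff {a b c z : Plane} (h : 0 < orient a b c) :
    z ∈ convexHull ℝ ({a, b, c} : Set Plane) ↔
      0 ≤ orient a b z ∧ 0 ≤ orient b c z ∧ 0 ≤ orient c a z := by
  constructor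
  · intro hz
    have key : ∀ p q : Plane, 0 ≤ orient p q a → 0 ≤ orient p q b → 0 ≤ orient p q c →
        0 ≤ orient p q z := by
      intro p q h1 h2 h3
      refine convexHull_min ?_ (convex_orient_nonneg p q) hz
      rintro x (rfl | rfl | rfl) <;> assumption
    have h1 : 0 < orient b c a := by rwa [orient_rotate]
    have h2 : 0 < orient c a b := by rwa [orient_rotate, orient_rotate]
    refine ⟨key _ _ ?_ ?_ h.le, key _ _ h1.le ?_ ?_, key _ _ ?_ h2.le ?_⟩ <;> simp
  · rintro ⟨h1, h2, h3⟩
    have hsum : orient b c z + orient c a z + orient a b z = orient a b c := by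
      unfold orient; ring
    rw [triangle_combo h.ne' (z := z)]
    refine combo_mem_hull (by positivity) (by positivity) (by positivity) ?_
    field_simp
    exact hsum

theorem collinear_of_orient_eq_zero {a b c : Plane} (h : orient a b c = 0) :
    Collinear ℝ ({a, b, c} : Set Plane) := by
  by_cases hab : a = b
  · subst hab
    simpa using collinear_pair ℝ a c
  rw [collinear_iff_of_mem (p₀ := a) (by simp)]
  refine ⟨b - a, ?_⟩
  have hn : (b 0 - a 0) ^ 2 + (b 1 - a 1) ^ 2 ≠ 0 := by
    intro h0
    apply hab
    have h1 : b 0 - a 0 = 0 := by nlinarith [sq_nonneg (b 0 - a 0), sq_nonneg (b 1 - a 1)]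
    have h2 : b 1 - a 1 = 0 := by nlinarith [sq_nonneg (b 0 - a 0), sq_nonneg (b 1 - a 1)]
    exact plane_ext (by linarith) (by linarith)
  rintro p (rfl | rfl | rfl)
  · exact ⟨0, by simp⟩
  · exact ⟨1, by simp⟩
  · refine ⟨((b 0 - a 0) * (p 0 - a 0) + (b 1 - a 1) * (p 1 - a 1)) /
      ((b 0 - a 0) ^ 2 + (b 1 - a 1) ^ 2), ?_⟩
    unfold orient at h
    apply plane_ext <;>
      simp only [vadd_eq_add, PiLp.add_apply, PiLp.smul_apply, PiLp.sub_apply, smul_eq_mul] <;>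
      field_simp
    · linear_combination -(b 1 - a 1) * h
    · linear_combination (b 0 - a 0) * h

theorem IsGeneric.orient_ne_zero {A : Finset Plane} (hA : IsGeneric A) {a b c : Plane}
    (ha : a ∈ A) (hb : b ∈ A) (hc : c ∈ A) (hab : a ≠ b) (hbc : b ≠ c) (hac : a ≠ c) :
    orient a b c ≠ 0 := by
  intro h
  refine hA.1 {a, b, c} ?_ (Finset.card_eq_three.2 ⟨a, b, c, hab, hac, hbc, rfl⟩) ?_
  · simp [Finset.insert_subset_iff, ha, hb, hc]
  · simpa using collinear_of_orient_eq_zero h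

theorem dist_sq (a b : Plane) : dist a b ^ 2 = (a 0 - b 0) ^ 2 + (a 1 - b 1) ^ 2 := by
  rw [EuclideanSpace.dist_eq, Real.sq_sqrt (by positivity)]
  simp [Real.dist_eq]

theorem exists_center (u v : Plane) (k : ℝ) :
    ∃ c : Plane, ∀ y, dotAt u v y - k * orient u v y = dist y c ^ 2 - dist u c ^ 2 := by
  -- The value k = 0 gives the circle with diameter uv; general k shifts its center along the
  -- bisector of uv by k/2 times v - u turned by a right angle.
  refine ⟨!₂[(u 0 + v 0) / 2 - k * (v 1 - u 1) / 2, (u 1 + v 1) / 2 + k * (v 0 - u 0) / 2], ?_⟩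
  intro y
  rw [dist_sq, dist_sq]
  simp [dotAt, orient]
  ring

theorem pow_eq_of_dist {u v w y c : Plane} {r : ℝ} (hw : orient u v w ≠ 0)
    (hu : dist u c = r) (hv : dist v c = r) (hr : dist w c = r) :
    pow u v w y = dist y c ^ 2 - r ^ 2 := by
  have h1 := dist_sq u c
  have h2 := dist_sq v c
  have h3 := dist_sq w c
  rw [hu] at h1
  rw [hv] at h2
  rw [hr] at h3
  rw [dist_sq, pow]
  field_simp
  unfold dotAt orient
  -- The multipliers are the unnormalized barycentric coordinates of y with respect to u, v, w.
  linear_combination (((v 0 - y 0) * (w 1 - y 1) - (v 1 - y 1) * (w 0 - y 0)) * h1 +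
    ((y 0 - u 0) * (w 1 - u 1) - (y 1 - u 1) * (w 0 - u 0)) * h2 +
    ((v 0 - u 0) * (y 1 - u 1) - (v 1 - u 1) * (y 0 - u 0)) * h3)

theorem pow_left (u v w : Plane) : pow u v w u = 0 := by simp [pow, dotAt]

theorem pow_mid (u v w : Plane) : pow u v w v = 0 := by simp [pow, dotAt]

theorem pow_right {u v w : Plane} (h : orient u v w ≠ 0) : pow u v w w = 0 := by
  unfold pow; field_simp; ring

theorem orient_rotate' (a b c : Plane) : orient c a b = orient a b c := by
  unfold orient; ring

theorem pow_swap (u v w y : Plane) : pow v u w y = pow u v w y := by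
  unfold pow
  rw [orient_swap u v w, orient_swap u v y, dotAt_comm u v, dotAt_comm u v]
  ring

/-- The definition of `pow` singles out the edge uv, but the circle does not depend on that choice.
-/
theorem pow_rotate {u v w : Plane} (y : Plane) (h : orient u v w ≠ 0) :
    pow v w u y = pow u v w y := by
  unfold pow
  rw [orient_rotate u v w]
  field_simp
  unfold dotAt orient
  ring

theorem exists_pow_eq (u v w : Plane) :
    ∃ c : Plane, ∀ y, pow u v w y = dist y c ^ 2 - dist u c ^ 2 :=
  exists_center u v _

theorem IsGeneric.pow_ne_zero {A : Finset Plane} (hA : IsGeneric A) {a b c d : Plane}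
    (ha : a ∈ A) (hb : b ∈ A) (hc : c ∈ A) (hd : d ∈ A) (hab : a ≠ b) (hbc : b ≠ c) (hac : a ≠ c)
    (hda : d ≠ a) (hdb : d ≠ b) (hdc : d ≠ c) : pow a b c d ≠ 0 := by
  intro h
  have ho := hA.orient_ne_zero ha hb hc hab hbc hac
  obtain ⟨o, hp⟩ := exists_pow_eq a b c
  refine hA.2 {d, a, b, c} ?_ ?_ ⟨o, dist a o, ?_⟩
  · simp [Finset.insert_subset_iff, ha, hb, hc, hd]
  · rw [Finset.card_insert_of_notMem (by simp [*]),
      Finset.card_eq_three.2 ⟨a, b, c, hab, hac, hbc, rfl⟩]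
  · have key : ∀ p, pow a b c p = 0 → dist p o = dist a o := by
      intro p h0
      rw [hp] at h0
      exact (sq_eq_sq₀ dist_nonneg dist_nonneg).1 (by linarith)
    intro p hm
    simp only [Finset.coe_insert, Finset.coe_singleton, Set.mem_insert_iff,
      Set.mem_singleton_iff] at hm
    rcases hm with rfl | rfl | rfl | rfl
    · exact key _ h
    · rfl
    · exact key _ (pow_mid _ _ _)
    · exact key _ (pow_right ho)

/-! ### Angles through their cotangents -/

theorem angle_eq_arctan {a y b : Plane} (h : 0 < orient a b y) :
    EuclideanGeometry.angle a y b = Real.pi / 2 - Real.arctan (dotAt a b y / orient a b y) := by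
  rw [Real.arctan_eq_arcsin, ← Real.arccos_eq_pi_div_two_sub_arcsin,
    EuclideanGeometry.angle, InnerProductGeometry.angle]
  congr 1
  have hi : inner ℝ (a -ᵥ y) (b -ᵥ y) = dotAt a b y := by
    simp [PiLp.inner_apply, Fin.sum_univ_two, dotAt]
    ring
  -- Lagrange's identity: the product of the squared lengths is `dotAt ^ 2 + orient ^ 2`.
  have hn : ‖a -ᵥ y‖ * ‖b -ᵥ y‖ = orient a b y * √(1 + (dotAt a b y / orient a b y) ^ 2) := by
    rw [← sq_eq_sq₀ (by positivity) (by positivity), mul_pow, mul_pow,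
      Real.sq_sqrt (by positivity), ← dist_eq_norm_vsub, ← dist_eq_norm_vsub, dist_sq, dist_sq]
    field_simp
    unfold dotAt orient
    ring
  rw [hi, hn, div_div]

theorem angle_le_iff {a y b a' y' b' : Plane} (h : 0 < orient a b y) (h' : 0 < orient a' b' y') :
    EuclideanGeometry.angle a y b ≤ EuclideanGeometry.angle a' y' b' ↔
      dotAt a' b' y' * orient a b y ≤ dotAt a b y * orient a' b' y' := by
  rw [angle_eq_arctan h, angle_eq_arctan h', sub_le_sub_iff_left,
    Real.arctan_strictMono.le_iff_le, div_le_div_iff₀ h' h]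

theorem mem_interior_triangle {a b c z : Plane} (h : 0 < orient a b c) (h1 : 0 < orient a b z)
    (h2 : 0 < orient b c z) (h3 : 0 < orient c a z) :
    z ∈ interior (convexHull ℝ ({a, b, c} : Set Plane)) := by
  rw [mem_interior]
  refine ⟨{z | 0 < orient a b z} ∩ ({z | 0 < orient b c z} ∩ {z | 0 < orient c a z}), ?_, ?_,
    h1, h2, h3⟩
  · rintro y ⟨h1, h2, h3⟩
    exact (mem_triangle_iff h).2 ⟨le_of_lt h1, le_of_lt h2, le_of_lt h3⟩
  · exact (isOpen_lt continuous_const (continuous_orient _ _)).inter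
      ((isOpen_lt continuous_const (continuous_orient _ _)).inter
        (isOpen_lt continuous_const (continuous_orient _ _)))

theorem isClosed_hull (T : Finset Plane) : IsClosed (convexHull ℝ (T : Set Plane)) :=
  (T.finite_toSet.isCompact_convexHull ℝ).isClosed

/-! ### Germs of curves and the triangles that contain them -/

/-- A curve that leaves `u` in the direction of `v`, on the side of `w`. -/
noncomputable def germ (u v w : Plane) (ε : ℝ) : Plane :=
  u + ε • (v - u) + ε ^ 2 • (w - u)

theorem orient_germ (a b u v w : Plane) (ε : ℝ) : orient a b (germ u v w ε) =
    (1 - ε - ε ^ 2) * orient a b u + ε * orient a b v + ε ^ 2 * orient a b w := by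
  simp only [germ, orient, PiLp.add_apply, PiLp.smul_apply, PiLp.sub_apply, smul_eq_mul]
  ring

theorem tendsto_germ (u v w : Plane) : Tendsto (germ u v w) (𝓝[>] 0) (𝓝 u) := by
  have : Continuous (germ u v w) := by unfold germ; fun_prop
  have h := this.tendsto 0
  simp only [germ, zero_smul, ne_eq, OfNat.ofNat_ne_zero, not_false_eq_true, zero_pow,
    add_zero] at h
  exact h.mono_left nhdsWithin_le_nhds

theorem eventually_small_pos {a b c : ℝ} (h : 0 < a) :
    ∀ᶠ ε in 𝓝[>] (0 : ℝ), 0 < a + ε * b + ε ^ 2 * c := by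
  have : Continuous fun ε : ℝ => a + ε * b + ε ^ 2 * c := by fun_prop
  have h0 := this.tendsto 0
  exact (h0.eventually (lt_mem_nhds (by simpa using h))).filter_mono nhdsWithin_le_nhds

theorem eventually_pos : ∀ᶠ ε in 𝓝[>] (0 : ℝ), 0 < ε := self_mem_nhdsWithin

theorem eventually_orient_germ {a b u v w : Plane} (h : 0 < orient a b u) :
    ∀ᶠ ε in 𝓝[>] (0 : ℝ), 0 < orient a b (germ u v w ε) := by
  filter_upwards [eventually_small_pos (b := orient a b v - orient a b u)
    (c := orient a b w - orient a b u) h] with ε hε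
  rw [orient_germ]
  linarith

theorem eventually_orient_germ_left {b u v w : Plane} (h : 0 < orient u b v) :
    ∀ᶠ ε in 𝓝[>] (0 : ℝ), 0 < orient u b (germ u v w ε) := by
  filter_upwards [eventually_small_pos (b := orient u b w) (c := 0) h, eventually_pos]
    with ε hε hpos
  rw [orient_germ, orient_self_outer]
  have := mul_pos hpos hε
  linarith

theorem germ_eventually_mem_interior {u v w : Plane} (h : 0 < orient u v w) :
    ∀ᶠ ε in 𝓝[>] (0 : ℝ), germ u v w ε ∈ interior (convexHull ℝ ({u, v, w} : Set Plane)) := by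
  filter_upwards [eventually_orient_germ (a := v) (b := w) (u := u) (v := v) (w := w)
    (by rwa [orient_rotate]), eventually_pos] with ε h1 h2
  refine mem_interior_triangle h ?_ h1 ?_
  · rw [orient_germ]
    simp only [orient_self_outer, orient_self_right, mul_zero, zero_add]
    positivity
  · rw [orient_germ, orient_rotate' u v w]
    simp only [orient_self_outer, orient_self_right, mul_zero, zero_add, add_zero]
    positivity

theorem germ_eventually_mem_hull (u v w : Plane) :
    ∀ᶠ ε in 𝓝[>] (0 : ℝ), germ u v w ε ∈ convexHull ℝ ({u, v, w} : Set Plane) := by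
  filter_upwards [eventually_small_pos (a := 1) (b := -1) (c := -1) one_pos, eventually_pos]
    with ε h1 h2
  have e : germ u v w ε = (1 - ε - ε ^ 2) • u + ε • v + ε ^ 2 • w := by
    unfold germ
    module
  rw [e]
  exact combo_mem_hull (by linarith) h2.le (by positivity) (by ring)

/-- The triangle `upq` contains the germ of the segment `uv` at `u`, together with the germ of the
side of `uv` that contains `p`, and either `q = v` or the edge `pq` separates `u` from `v`. -/
structure Crosses (u v p q : Plane) : Prop where
  above : 0 < orient u v p
  pos : 0 < orient u q p
  beyond : orient q p v ≤ 0
  below : q = v ∨ orient u v q < 0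

theorem Crosses.orient_germ_pos {u v w p q : Plane} (hc : Crosses u v p q)
    (h : q = v ∧ 0 < orient u v w ∨ orient u v q < 0) :
    ∀ᶠ ε in 𝓝[>] (0 : ℝ), 0 < orient u q (germ u v w ε) ∧ 0 < orient q p (germ u v w ε) ∧
      0 < orient p u (germ u v w ε) := by
  have e1 : ∀ᶠ ε in 𝓝[>] (0 : ℝ), 0 < orient u q (germ u v w ε) := by
    rcases h with ⟨rfl, h⟩ | hq
    · filter_upwards [eventually_pos] with ε hε
      rw [orient_germ]
      simp only [orient_self_outer, orient_self_right, mul_zero, zero_add]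
      positivity
    · apply eventually_orient_germ_left
      have : orient u q v = -orient u v q := by unfold orient; ring
      linarith
  have e2 : ∀ᶠ ε in 𝓝[>] (0 : ℝ), 0 < orient q p (germ u v w ε) :=
    eventually_orient_germ (by rw [orient_rotate]; exact hc.pos)
  have e3 : ∀ᶠ ε in 𝓝[>] (0 : ℝ), 0 < orient p u (germ u v w ε) := by
    filter_upwards [eventually_small_pos (b := orient p u w) (c := 0) hc.above, eventually_pos]
      with ε hε hpos
    rw [orient_germ, orient_self_right, orient_rotate']
    have := mul_pos hpos hε
    linarith
  exact e1.and (e2.and e3)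

theorem Crosses.germ_eventually {u v w p q : Plane} (hc : Crosses u v p q)
    (h : 0 < orient u v w) :
    ∀ᶠ ε in 𝓝[>] (0 : ℝ), germ u v w ε ∈ interior (convexHull ℝ ({u, p, q} : Set Plane)) := by
  filter_upwards [hc.orient_germ_pos (hc.below.imp_left fun e => ⟨e, h⟩)] with ε ⟨h1, h2, h3⟩
  rw [Set.pair_comm p q]
  exact mem_interior_triangle hc.pos h1 h2 h3

/-- The ray from p through q stays inside the angle upv. In cotangents, the difference is |u - p|²
times a signed area whose sign is `beyond`. -/
theorem Crosses.angle_le {u v p q : Plane} (hc : Crosses u v p q) :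
    EuclideanGeometry.angle u p q ≤ EuclideanGeometry.angle u p v := by
  rw [angle_le_iff hc.pos hc.above]
  have key : dotAt u q p * orient u v p - dotAt u v p * orient u q p =
      ((u 0 - p 0) ^ 2 + (u 1 - p 1) ^ 2) * -orient q p v := by
    unfold dotAt orient; ring
  have := mul_nonneg (a := (u 0 - p 0) ^ 2 + (u 1 - p 1) ^ 2) (b := -orient q p v)
    (by positivity) (by linarith [hc.beyond])
  linarith

theorem exists_eq_insert {T : Finset Plane} (h3 : T.card = 3) {u : Plane} (hu : u ∈ T) :
    ∃ p q, T = {u, p, q} ∧ u ≠ p ∧ u ≠ q ∧ p ≠ q := by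
  obtain ⟨a, b, c, hab, hac, hbc, rfl⟩ := Finset.card_eq_three.1 h3
  simp only [Finset.mem_insert, Finset.mem_singleton] at hu
  rcases hu with rfl | rfl | rfl
  · exact ⟨b, c, rfl, hab, hac, hbc⟩
  · exact ⟨a, c, by ext; simp; tauto, hab.symm, hbc, hac⟩
  · exact ⟨a, b, by ext; simp; tauto, hac.symm, hbc.symm, hab⟩

theorem exists_eq_insert_of_pos {A : Finset Plane} (hA : IsGeneric A) {T : Finset Plane}
    (hT : T ⊆ A) (h3 : T.card = 3) {u : Plane} (hu : u ∈ T) :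
    ∃ p q, T = {u, p, q} ∧ p ∈ A ∧ q ∈ A ∧ 0 < orient u q p := by
  obtain ⟨p, q, rfl, hup, huq, hpq⟩ := exists_eq_insert h3 hu
  have hp : p ∈ A := hT (by simp)
  have hq : q ∈ A := hT (by simp)
  rcases lt_or_gt_of_ne (hA.orient_ne_zero (hT hu) hp hq hup hpq huq) with h | h
  · refine ⟨p, q, rfl, hp, hq, ?_⟩
    have : orient u q p = -orient u p q := by unfold orient; ring
    linarith
  · exact ⟨q, p, by rw [Finset.pair_comm], hq, hp, h⟩

/-! ### Pure families and white regions -/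

/-- A family of triangles spanned by `A` that contain no points of `A` except for their vertices. -/
structure IsPure (A : Finset Plane) (C : Set (Finset Plane)) : Prop where
  subset : ∀ T ∈ C, T ⊆ A
  card : ∀ T ∈ C, T.card = 3
  vertex : ∀ T ∈ C, ∀ a ∈ A, a ∈ convexHull ℝ (T : Set Plane) → a ∈ T

theorem finite_of_subset {A : Finset Plane} {C : Set (Finset Plane)} (h : ∀ T ∈ C, T ⊆ A) :
    C.Finite :=
  A.powerset.finite_toSet.subset fun T hT => Finset.mem_coe.2 (Finset.mem_powerset.2 (h T hT))

theorem frequently_mem_hull {C : Set (Finset Plane)} (hC : C.Finite) {γ : ℝ → Plane} {u : Plane}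
    (hγ : Tendsto γ (𝓝[>] 0) (𝓝 u))
    (hf : ∃ᶠ ε in 𝓝[>] (0 : ℝ), γ ε ∈ ⋃ T ∈ C, convexHull ℝ (T : Set Plane)) :
    ∃ T ∈ C, u ∈ convexHull ℝ (T : Set Plane) ∧
      ∃ᶠ ε in 𝓝[>] (0 : ℝ), γ ε ∈ convexHull ℝ (T : Set Plane) := by
  obtain ⟨T, hT, h⟩ : ∃ T ∈ C, ∃ᶠ ε in 𝓝[>] (0 : ℝ), γ ε ∈ convexHull ℝ (T : Set Plane) := by
    by_contra! hcon
    apply hf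
    have := (hC.eventually_all (l := 𝓝[>] (0 : ℝ))
      (p := fun T ε => γ ε ∉ convexHull ℝ (T : Set Plane))).2
      fun T hT => hcon T hT
    filter_upwards [this] with ε h h'
    simp only [Set.mem_iUnion] at h'
    obtain ⟨T, hT, hm⟩ := h'
    exact h T hT hm
  exact ⟨T, hT, (isClosed_hull T).mem_of_frequently_of_tendsto h hγ, h⟩

theorem nonneg_of_frequently {a b : ℝ} (h : ∃ᶠ ε in 𝓝[>] (0 : ℝ), 0 ≤ ε * a + ε ^ 2 * b) :
    0 ≤ a := by
  by_contra! ha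
  apply h
  filter_upwards [eventually_small_pos (a := -a) (b := -b) (c := 0) (by linarith), eventually_pos]
    with ε h1 h2 h3
  have := mul_pos h2 h1
  linarith

/-- One of the finitely many triangles contains the germ for arbitrarily small ε; it is closed, so
it contains u, and purity makes u a vertex. The leading terms of the germ locate p and q, and purity
applied to v keeps v from lying before the edge pq. -/
theorem IsPure.exists_crosses {A : Finset Plane} (hA : IsGeneric A) {C : Set (Finset Plane)}
    {B : Finset Plane} (hBA : B ⊆ A) (hC : IsPure B C) {u v w : Plane} (hu : u ∈ B) (hv : v ∈ B)
    (h : 0 < orient u v w)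
    (hf : ∃ᶠ ε in 𝓝[>] (0 : ℝ), germ u v w ε ∈ ⋃ T ∈ C, convexHull ℝ (T : Set Plane)) :
    ∃ p q, {u, p, q} ∈ C ∧ Crosses u v p q := by
  obtain ⟨T, hT, huT, hg⟩ :=
    frequently_mem_hull (finite_of_subset hC.subset) (tendsto_germ u v w) hf
  have huv : u ≠ v := by
    rintro rfl
    simp at h
  obtain ⟨p, q, rfl, hp, hq, hpos⟩ := exists_eq_insert_of_pos hA ((hC.subset T hT).trans hBA)
    (hC.card T hT) (hC.vertex T hT u hu huT)
  have hset : (({u, p, q} : Finset Plane) : Set Plane) = {u, q, p} := by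
    simp [Set.pair_comm]
  have hg1 : ∃ᶠ ε in 𝓝[>] (0 : ℝ), 0 ≤ ε * orient u q v + ε ^ 2 * orient u q w := by
    refine hg.mono fun ε hε => ?_
    rw [hset, mem_triangle_iff hpos] at hε
    simpa [orient_germ] using hε.1
  have hg2 : ∃ᶠ ε in 𝓝[>] (0 : ℝ), 0 ≤ ε * orient p u v + ε ^ 2 * orient p u w := by
    refine hg.mono fun ε hε => ?_
    rw [hset, mem_triangle_iff hpos] at hε
    simpa [orient_germ] using hε.2.2
  have huq : u ≠ q := by
    rintro rfl
    simp at hpos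
  have hup : u ≠ p := by
    rintro rfl
    simp at hpos
  have hbelow : q = v ∨ orient u v q < 0 := by
    by_cases hqv : q = v
    · exact Or.inl hqv
    · right
      have h1 := nonneg_of_frequently hg1
      have h2 := hA.orient_ne_zero (hBA hu) (hBA hv) hq huv (Ne.symm hqv) huq
      have : orient u q v = -orient u v q := by unfold orient; ring
      exact lt_of_le_of_ne (by linarith) h2
  have habove : 0 < orient u v p := by
    have h1 := nonneg_of_frequently hg2
    rw [orient_rotate'] at h1
    refine lt_of_le_of_ne h1 fun h0 => ?_
    -- With p = v the triangle would lie below uv, while the second-order term of the germ lifts it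
    -- above.
    have hpv : p = v := by
      by_contra hpv
      exact hA.orient_ne_zero (hBA hu) (hBA hv) hp huv (Ne.symm hpv) hup h0.symm
    subst hpv
    apply hg2
    filter_upwards [eventually_pos] with ε hε
    rw [orient_self_outer, orient_swap]
    have : 0 < ε ^ 2 * orient u p w := by positivity
    linarith
  refine ⟨p, q, hT, habove, hpos, ?_, hbelow⟩
  rcases hbelow with rfl | hq'
  · simp
  by_contra! hcon
  have hvT : v ∈ convexHull ℝ ((({u, p, q} : Finset Plane)) : Set Plane) := by
    rw [hset, mem_triangle_iff hpos]
    refine ⟨?_, hcon.le, ?_⟩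
    · have : orient u q v = -orient u v q := by unfold orient; ring
      linarith
    · rw [orient_rotate']
      exact habove.le
  have := hC.vertex _ hT v hv hvT
  simp only [Finset.mem_insert, Finset.mem_singleton] at this
  rcases this with rfl | rfl | rfl
  · exact huv rfl
  · simp at habove
  · simp at hq'

/-- A pure family of triangles that covers the convex hull of `A`. -/
structure IsPureCover (A : Finset Plane) (P : Set (Finset Plane)) : Prop extends IsPure A P where
  cover : convexHull ℝ (A : Set Plane) ⊆ ⋃ T ∈ P, convexHull ℝ (T : Set Plane)

theorem orient_eq_zero_of_mem_segment {a b c : Plane}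
    (h : a ∈ convexHull ℝ ({b, c} : Set Plane)) : orient a b c = 0 := by
  rw [convexHull_pair] at h
  obtain ⟨s, t, -, -, hst, rfl⟩ := h
  rw [← orient_rotate, orient_combo _ _ _ _ hst]
  simp

/-- Completeness supplies a triangle T' with vertex a. If a lay in T without being a vertex of T,
the common face would put a on the edge of T' opposite to a. -/
theorem IsCompleteTriangulation.isPureCover {A : Finset Plane} (hA : IsGeneric A)
    {P : Set (Finset Plane)} (hP : IsCompleteTriangulation A P) : IsPureCover A P where
  subset T hT := by exact_mod_cast hP.1.vertices T hT
  card := hP.1.card_eq_three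
  cover := hP.1.cover.ge
  vertex T hT a ha haT := by
    by_contra hn
    obtain ⟨T', hT', haT'⟩ := hP.2 a ha
    have hm : a ∈ convexHull ℝ ((T : Set Plane) ∩ (T' : Set Plane)) := by
      rw [← hP.1.edge_to_edge T hT T' hT']
      exact ⟨haT, subset_convexHull ℝ _ haT'⟩
    have hsub : T' ⊆ A := by exact_mod_cast hP.1.vertices T' hT'
    obtain ⟨p, q, rfl, hp, hq, hpos⟩ :=
      exists_eq_insert_of_pos hA hsub (hP.1.card_eq_three T' hT') haT'
    have : a ∈ convexHull ℝ ({q, p} : Set Plane) := by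
      refine convexHull_mono ?_ hm
      rintro y ⟨hy, hy'⟩
      have : y ≠ a := by
        rintro rfl
        exact hn hy
      simp only [Finset.coe_insert, Finset.coe_singleton, Set.mem_insert_iff,
        Set.mem_singleton_iff] at hy' ⊢
      tauto
    exact hpos.ne' (orient_eq_zero_of_mem_segment this)

theorem mem_interior_hull {A : Finset Plane} (hA : IsGeneric A) {T : Finset Plane}
    (hT : T ⊆ A) (h3 : T.card = 3) {a : Plane} (ha : a ∈ A) (haT : a ∈ convexHull ℝ (T : Set Plane))
    (hn : a ∉ T) : a ∈ interior (convexHull ℝ (T : Set Plane)) := by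
  obtain ⟨b, hb⟩ : T.Nonempty := Finset.card_pos.1 (by omega)
  obtain ⟨p, q, rfl, hp, hq, hpos⟩ := exists_eq_insert_of_pos hA hT h3 hb
  have hset : (({b, p, q} : Finset Plane) : Set Plane) = {b, q, p} := by
    simp [Set.pair_comm]
  rw [hset] at haT ⊢
  obtain ⟨h1, h2, h3⟩ := (mem_triangle_iff hpos).1 haT
  simp only [Finset.mem_insert, Finset.mem_singleton, not_or] at hn
  obtain ⟨hn1, hn2, hn3⟩ := hn
  have hbq : b ≠ q := by
    rintro rfl
    simp at hpos
  have hbp : b ≠ p := by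
    rintro rfl
    simp at hpos
  have hpq : q ≠ p := by
    rintro rfl
    simp at hpos
  refine mem_interior_triangle hpos (lt_of_le_of_ne h1 ?_) (lt_of_le_of_ne h2 ?_)
    (lt_of_le_of_ne h3 ?_) <;> symm
  · exact hA.orient_ne_zero (hT hb) hq ha hbq (Ne.symm hn3) (Ne.symm hn1)
  · exact hA.orient_ne_zero hq hp ha hpq (Ne.symm hn2) (Ne.symm hn3)
  · exact hA.orient_ne_zero hp (hT hb) ha hbp.symm (Ne.symm hn1) (Ne.symm hn2)

theorem isClosed_star {A : Finset Plane} {P : Set (Finset Plane)} (hP : ∀ T ∈ P, T ⊆ A)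
    (x : Plane) : IsClosed (star P x) :=
  (finite_of_subset fun _ hT => hP _ hT.1).isClosed_biUnion fun T _ => isClosed_hull T

/-- Moving from a straight away from x leaves every triangle that has both a and x as vertices. -/
theorem IsPure.notMem_interior_star {A : Finset Plane} (hA : IsGeneric A) {P : Set (Finset Plane)}
    (hP : IsPure A P) {a x : Plane} (ha : a ∈ A) (hax : a ≠ x) : a ∉ interior (star P x) := by
  intro hm
  set γ : ℝ → Plane := fun ε => a + ε • (a - x) with hγ
  have hcont : Continuous γ := by fun_prop
  have htend : Tendsto γ (𝓝[>] 0) (𝓝 a) := by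
    have h := hcont.tendsto 0
    simp only [hγ, zero_smul, add_zero] at h
    exact h.mono_left nhdsWithin_le_nhds
  have hev : ∀ᶠ ε in 𝓝[>] (0 : ℝ), γ ε ∈ star P x :=
    htend.eventually (mem_interior_iff_mem_nhds.1 hm)
  obtain ⟨T, ⟨hT, hxT⟩, haT, hf⟩ := frequently_mem_hull
    (C := {T | T ∈ P ∧ x ∈ T}) (finite_of_subset fun T hT => hP.subset T hT.1) htend
    hev.frequently
  have haT' := hP.vertex T hT a ha haT
  obtain ⟨p, q, rfl, hp, hq, hpos⟩ :=
    exists_eq_insert_of_pos hA (hP.subset T hT) (hP.card T hT) haT'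
  have hset : (({a, p, q} : Finset Plane) : Set Plane) = {a, q, p} := by
    simp [Set.pair_comm]
  obtain ⟨ε, hε, hε0⟩ := (hf.and_eventually eventually_pos).exists
  rw [hset, mem_triangle_iff hpos] at hε
  have hpr := mul_pos hε0 hpos
  simp only [Finset.mem_insert, Finset.mem_singleton] at hxT
  rcases hxT with rfl | rfl | rfl
  · exact hax rfl
  · have : orient a q (γ ε) = -(ε * orient a q x) := by
      simp only [hγ, orient, PiLp.add_apply, PiLp.smul_apply, PiLp.sub_apply, smul_eq_mul]
      ring
    linarith [hε.1]
  · have : orient p a (γ ε) = -(ε * orient a x p) := by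
      simp only [hγ, orient, PiLp.add_apply, PiLp.smul_apply, PiLp.sub_apply, smul_eq_mul]
      ring
    linarith [hε.2.2]

theorem IsPure.white {A : Finset Plane} (hA : IsGeneric A) {P : Set (Finset Plane)}
    (hP : IsPure A P) {x : Plane} {W : Set (Finset Plane)}
    (hW : IsConstrainedDelaunay (whiteRegion A P x) (neighbors P x) W) :
    IsPure (A.erase x) W := by
  have hsub : ∀ T ∈ W, T ⊆ A.erase x := by
    intro T hT a ha
    obtain ⟨hax, T', hT', -, haT'⟩ := hW.1.vertices T hT (Finset.mem_coe.2 ha)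
    exact Finset.mem_erase.2 ⟨hax, hP.subset T' hT' haT'⟩
  refine ⟨hsub, hW.1.card_eq_three, ?_⟩
  intro T hT a ha haT
  by_contra hn
  have hi := mem_interior_hull hA ((hsub T hT).trans (Finset.erase_subset _ _))
    (hW.1.card_eq_three T hT) (Finset.mem_of_mem_erase ha) haT hn
  refine hP.notMem_interior_star hA (Finset.mem_of_mem_erase ha) (Finset.ne_of_mem_erase ha)
    (interior_mono ?_ hi)
  have h1 : convexHull ℝ (T : Set Plane) ⊆ closure (interior (whiteRegion A P x)) := by
    rw [← hW.1.cover]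
    exact Set.subset_biUnion_of_mem (u := fun T : Finset Plane => convexHull ℝ (T : Set Plane)) hT
  have h2 : closure (interior (whiteRegion A P x)) ⊆ star P x :=
    closure_minimal (interior_subset.trans Set.inter_subset_left) (isClosed_star hP.subset x)
  exact h1.trans h2

/-- The germ is interior to upq, hence to the star of x, and interior to uvw, hence to the convex
hull of A without x. So it runs in the white region of x. -/
theorem IsPure.exists_crosses_white {A : Finset Plane} (hA : IsGeneric A) {P : Set (Finset Plane)}
    (hP : IsPure A P) {x : Plane} {W : Set (Finset Plane)}
    (hW : IsConstrainedDelaunay (whiteRegion A P x) (neighbors P x) W) {u v w p q : Plane}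
    (hu : u ∈ A.erase x) (hv : v ∈ A.erase x) (hw : w ∈ A.erase x) (h : 0 < orient u v w)
    (hT : {u, p, q} ∈ P) (hx : x ∈ ({u, p, q} : Finset Plane)) (hc : Crosses u v p q) :
    ∃ p' q', {u, p', q'} ∈ W ∧ Crosses u v p' q' := by
  refine (hP.white hA hW).exists_crosses hA (Finset.erase_subset _ _) hu hv h
    (Eventually.frequently ?_)
  filter_upwards [hc.germ_eventually h, germ_eventually_mem_interior h] with ε h1 h2
  rw [hW.1.cover]
  apply subset_closure
  rw [whiteRegion, interior_inter]
  constructor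
  · refine interior_mono ?_ h1
    have := Set.subset_biUnion_of_mem (s := {T | T ∈ P ∧ x ∈ T})
      (u := fun T : Finset Plane => convexHull ℝ (T : Set Plane)) ⟨hT, hx⟩
    simpa [star] using this
  · refine interior_mono (convexHull_mono ?_) h2
    rintro y (rfl | rfl | rfl)
    · simpa [and_comm] using hu
    · simpa [and_comm] using hv
    · simpa [and_comm] using hw

/-! ### Comparison with an angle of f(P) -/

theorem Crosses.mem_angles {u v p q : Plane} (hc : Crosses u v p q) {Φ : Set (Finset Plane)}
    (hT : {u, p, q} ∈ Φ) : EuclideanGeometry.angle u p q ∈ angles Φ := by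
  have hpos := hc.pos
  refine ⟨_, hT, u, by simp, p, by simp, q, by simp, ?_, ?_, ?_, rfl⟩ <;> rintro rfl <;>
    simp at hpos

theorem angle_le_of_pow_nonneg {u v w p : Plane} (h : 0 < orient u v w) (hp : 0 < orient u v p)
    (h0 : 0 ≤ pow u v w p) :
    EuclideanGeometry.angle u p v ≤ EuclideanGeometry.angle u w v := by
  rw [angle_le_iff hp h]
  have := mul_nonneg h0 h.le
  rw [pow, sub_mul] at this
  have e : dotAt u v w / orient u v w * orient u v p * orient u v w =
      dotAt u v w * orient u v p := by
    field_simp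
  linarith

theorem exists_angle_le {A : Finset Plane} (hA : IsGeneric A) {P Φ : Set (Finset Plane)}
    (hP : IsPureCover A P) (hΦ : IsAged A P Φ) {u v w : Plane} (hu : u ∈ A) (hv : v ∈ A)
    (hw : w ∈ A) (h : 0 < orient u v w)
    (hviol : ∀ y ∈ A, ∀ y' ∈ A, pow u v w y < 0 → pow u v w y' < 0 → y = y') :
    ∃ θ ∈ angles Φ, θ ≤ EuclideanGeometry.angle u w v := by
  obtain ⟨W, hW, rfl⟩ := hΦ
  obtain ⟨p, q, hT, hc⟩ := hP.toIsPure.exists_crosses hA subset_rfl hu hv h (by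
    refine Eventually.frequently ?_
    filter_upwards [germ_eventually_mem_interior h] with ε hε
    refine hP.cover (convexHull_mono ?_ (interior_subset hε))
    rintro y (rfl | rfl | rfl)
    exacts [hu, hv, hw])
  by_cases hp : 0 ≤ pow u v w p
  · exact ⟨_, hc.mem_angles (Or.inl hT),
      hc.angle_le.trans (angle_le_of_pow_nonneg h hc.above hp)⟩
  -- Now p is the unique point of A inside the circle, so the white triangles of p, which avoid p,
  -- can be used instead.
  push Not at hp
  have hpA : p ∈ A := hP.subset _ hT (by simp)
  have hne : ∀ z, pow u v w z = 0 → z ≠ p := by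
    rintro z hz rfl
    linarith
  obtain ⟨p', q', hT', hc'⟩ := hP.toIsPure.exists_crosses_white hA (hW p hpA)
    (Finset.mem_erase.2 ⟨hne u (pow_left _ _ _), hu⟩)
    (Finset.mem_erase.2 ⟨hne v (pow_mid _ _ _), hv⟩)
    (Finset.mem_erase.2 ⟨hne w (pow_right h.ne'), hw⟩) h hT (by simp) hc
  have hp' : p' ∈ A.erase p := (hP.toIsPure.white hA (hW p hpA)).subset _ hT' (by simp)
  have hp0 : 0 ≤ pow u v w p' := by
    by_contra! hcon
    exact Finset.ne_of_mem_erase hp' (hviol _ (Finset.mem_of_mem_erase hp') _ hpA hcon hp)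
  refine ⟨_, hc'.mem_angles (Or.inr ?_),
    hc'.angle_le.trans (angle_le_of_pow_nonneg h hc'.above hp0)⟩
  exact Set.mem_biUnion hpA hT'

/-! ### The Delaunay triangles cover the convex hull and do not overlap -/

theorem delaunay_iff {A : Finset Plane} {a b c : Plane} (ha : a ∈ A) (hb : b ∈ A) (hc : c ∈ A)
    (h : 0 < orient a b c) : {a, b, c} ∈ delaunay A ↔ ∀ y ∈ A, 0 ≤ pow a b c y := by
  constructor
  · rintro ⟨-, -, s, hs, hA⟩ y hy
    rw [pow_eq_of_dist h.ne' (hs a (by simp)) (hs b (by simp)) (hs c (by simp))]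
    have h1 := not_lt.1 (hA y hy)
    have h2 : 0 ≤ s.radius := by
      rw [← EuclideanGeometry.mem_sphere.1 (hs a (by simp))]
      exact dist_nonneg
    nlinarith
  · intro hA
    obtain ⟨o, ho⟩ := exists_pow_eq a b c
    refine ⟨by simp [Finset.insert_subset_iff, ha, hb, hc], Finset.card_eq_three.2
      ⟨a, b, c, ?_, ?_, ?_, rfl⟩, ⟨o, dist a o⟩, ?_, ?_⟩
    · rintro rfl
      simp at h
    · rintro rfl
      simp at h
    · rintro rfl
      simp at h
    · have key : ∀ p, pow a b c p = 0 → dist p o = dist a o := by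
        intro p h0
        rw [ho] at h0
        exact (sq_eq_sq₀ dist_nonneg dist_nonneg).1 (by linarith)
      intro p hp
      simp only [Finset.mem_insert, Finset.mem_singleton] at hp
      rcases hp with rfl | rfl | rfl
      · rfl
      · exact key _ (pow_mid _ _ _)
      · exact key _ (pow_right h.ne')
    · intro p hp hlt
      have h1 := hA p hp
      rw [ho] at h1
      have : dist p o < dist a o := hlt
      have h0 : 0 ≤ dist p o := dist_nonneg
      nlinarith

theorem pow_nonpos_of_mem {a b c z : Plane} (h : orient a b c ≠ 0)
    (hz : z ∈ convexHull ℝ ({a, b, c} : Set Plane)) : pow a b c z ≤ 0 := by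
  obtain ⟨o, ho⟩ := exists_pow_eq a b c
  have key : ∀ p, pow a b c p = 0 → dist p o ≤ dist a o := by
    intro p h0
    rw [ho] at h0
    exact ((sq_eq_sq₀ dist_nonneg dist_nonneg).1 (by linarith)).le
  have hb : z ∈ Metric.closedBall o (dist a o) := by
    refine convexHull_min ?_ (convex_closedBall _ _) hz
    rintro p (rfl | rfl | rfl)
    · exact key _ (pow_left _ _ _)
    · exact key _ (pow_mid _ _ _)
    · exact key _ (pow_right h)
  rw [ho]
  have h1 : dist z o ≤ dist a o := hb
  have h0 : 0 ≤ dist z o := dist_nonneg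
  nlinarith

theorem IsGeneric.mem_of_pow_eq_zero {A : Finset Plane} (hA : IsGeneric A) {a b c d : Plane}
    (ha : a ∈ A) (hb : b ∈ A) (hc : c ∈ A) (hd : d ∈ A) (h : 0 < orient a b c)
    (h0 : pow a b c d = 0) : d ∈ ({a, b, c} : Finset Plane) := by
  by_contra hn
  simp only [Finset.mem_insert, Finset.mem_singleton, not_or] at hn
  refine hA.pow_ne_zero ha hb hc hd ?_ ?_ ?_ hn.1 hn.2.1 hn.2.2 h0 <;> rintro rfl <;> simp at h

theorem exists_ccw {A : Finset Plane} (hA : IsGeneric A) {T : Finset Plane} (hT : T ⊆ A)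
    (h3 : T.card = 3) :
    ∃ a b c, T = {a, b, c} ∧ a ∈ A ∧ b ∈ A ∧ c ∈ A ∧ 0 < orient a b c := by
  obtain ⟨a, ha⟩ : T.Nonempty := Finset.card_pos.1 (by omega)
  obtain ⟨p, q, rfl, hp, hq, hpos⟩ := exists_eq_insert_of_pos hA hT h3 ha
  exact ⟨a, q, p, by rw [Finset.pair_comm], hT ha, hq, hp, hpos⟩

theorem isPure_delaunay {A : Finset Plane} (hA : IsGeneric A) : IsPure A (delaunay A) where
  subset _ hT := hT.1
  card _ hT := hT.2.1
  vertex T hT d hd hdT := by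
    obtain ⟨a, b, c, rfl, ha, hb, hc, hpos⟩ := exists_ccw hA hT.1 hT.2.1
    refine hA.mem_of_pow_eq_zero ha hb hc hd hpos (le_antisymm ?_ ?_)
    · exact pow_nonpos_of_mem hpos.ne' (by simpa using hdT)
    · exact (delaunay_iff ha hb hc hpos).1 hT d hd

/-- An empty circle through `u` and `v` can be moved through the side of `uv` that contains points
of `A` until it touches one of them. -/
theorem exists_empty_circle {A : Finset Plane} {u v : Plane} {k : ℝ}
    (hk : ∀ y ∈ A, 0 ≤ dotAt u v y - k * orient u v y) {a : Plane} (ha : a ∈ A)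
    (hpos : 0 < orient u v a) :
    ∃ s ∈ A, 0 < orient u v s ∧ ∀ y ∈ A, 0 ≤ pow u v s y := by
  -- The quotient is the parameter of the circle of the pencil through y, so its minimum is the
  -- first point touched.
  obtain ⟨s, hs, hmin⟩ := (A.filter fun y => 0 < orient u v y).exists_min_image
    (fun y => dotAt u v y / orient u v y) ⟨a, by simp [ha, hpos]⟩
  simp only [Finset.mem_filter] at hs hmin
  refine ⟨s, hs.1, hs.2, fun y hy => ?_⟩
  unfold pow
  rcases lt_or_ge 0 (orient u v y) with h | h
  · have h1 := hmin y ⟨hy, h⟩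
    rw [le_div_iff₀ h] at h1
    linarith
  · have h1 := hk y hy
    have h2 : k ≤ dotAt u v s / orient u v s := by
      rw [le_div_iff₀ hs.2]
      linarith [hk s hs.1]
    nlinarith

/-- The difference of the powers with respect to two circles through `u` and `v`. -/
theorem pow_sub_pow (u v p w y : Plane) : pow v u w y - pow u v p y =
    (dotAt u v p / orient u v p + dotAt v u w / orient v u w) * orient u v y := by
  unfold pow
  rw [dotAt_comm u v y, orient_swap u v y]
  ring

/-- The line uv is the radical axis, so the difference of powers has one sign on each side of it,
read off here at p. -/
theorem pow_lt_pow {u v p w a : Plane} (hp : 0 < orient u v p) (ha : 0 < orient u v a)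
    (h : 0 < pow v u w p) : pow u v p a < pow v u w a := by
  have h1 := pow_sub_pow u v p w p
  have h2 := pow_sub_pow u v p w a
  rw [pow_right hp.ne', sub_zero] at h1
  rw [h1] at h
  have := mul_pos (pos_of_mul_pos_left h hp.le) ha
  linarith

theorem pow_le_pow {u v p w a : Plane} (hw : 0 < orient v u w) (ha : 0 < orient u v a)
    (h : 0 ≤ pow u v p w) : pow u v p a ≤ pow v u w a := by
  have h1 := pow_sub_pow u v p w w
  have h2 := pow_sub_pow u v p w a
  rw [pow_right hw.ne', zero_sub, ← neg_eq_iff_eq_neg.2 (orient_swap u v w)] at h1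
  rw [mul_neg, neg_inj] at h1
  rw [h1] at h
  have := mul_nonneg (nonneg_of_mul_nonneg_left h hw) ha.le
  linarith

/-- The circle whose diameter is a closest pair of A is empty; it is the member k = 0 of the pencil
and can be moved to a third point. -/
theorem exists_delaunay {A : Finset Plane} (hA : IsGeneric A) (hcard : 3 ≤ A.card) :
    ∃ a ∈ A, ∃ b ∈ A, ∃ c ∈ A, 0 < orient a b c ∧ ∀ y ∈ A, 0 ≤ pow a b c y := by
  obtain ⟨a, b, ha, hb, hab⟩ := Finset.one_lt_card_iff.1 (by omega : 1 < A.card)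
  obtain ⟨⟨p, q⟩, hpq, hmin⟩ := A.offDiag.exists_min_image (fun z => dist z.1 z.2)
    ⟨(a, b), by simp [ha, hb, hab]⟩
  simp only [Finset.mem_offDiag] at hpq hmin
  obtain ⟨hp, hq, hne⟩ := hpq
  have key : ∀ y ∈ A, 0 ≤ dotAt p q y := by
    intro y hy
    by_cases hyp : y = p
    · subst hyp
      simp [dotAt]
    have h1 := hmin (y, p) ⟨hy, hp, hyp⟩
    have h2 : dist p q ^ 2 ≤ dist y p ^ 2 := by
      have : 0 ≤ dist p q := dist_nonneg
      nlinarith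
    rw [dist_sq, dist_sq] at h2
    unfold dotAt
    nlinarith [sq_nonneg (y 0 - q 0), sq_nonneg (y 1 - q 1)]
  obtain ⟨r, hr, hrn⟩ : ∃ r ∈ A, r ∉ ({p, q} : Finset Plane) := by
    refine Finset.exists_mem_notMem_of_card_lt_card ?_
    have := Finset.card_le_two (a := p) (b := q)
    omega
  simp only [Finset.mem_insert, Finset.mem_singleton, not_or] at hrn
  rcases lt_or_gt_of_ne (hA.orient_ne_zero hp hq hr hne (Ne.symm hrn.2) (Ne.symm hrn.1)) with h | h
  · obtain ⟨s, hs, hs1, hs2⟩ := exists_empty_circle (u := q) (v := p) (k := 0)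
      (fun y hy => by rw [dotAt_comm]; simpa using key y hy) hr (by rw [orient_swap]; linarith)
    exact ⟨q, hq, p, hp, s, hs, hs1, hs2⟩
  · obtain ⟨s, hs, hs1, hs2⟩ := exists_empty_circle (u := p) (v := q) (k := 0)
      (fun y hy => by simpa using key y hy) hr h
    exact ⟨p, hp, q, hq, s, hs, hs1, hs2⟩

theorem exists_orient_pos {A : Finset Plane} {z : Plane} (hz : z ∈ convexHull ℝ (A : Set Plane))
    {u v : Plane} (h : 0 < orient u v z) : ∃ a ∈ A, 0 < orient u v a := by
  by_contra! hcon
  have : z ∈ {z | 0 ≤ orient v u z} := by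
    refine convexHull_min ?_ (convex_orient_nonneg v u) hz
    intro a ha
    have := hcon a ha
    simp only [Set.mem_ofPred_eq]
    rw [orient_swap]
    linarith
  simp only [Set.mem_ofPred_eq] at this
  rw [orient_swap] at this
  linarith

theorem exists_delaunay_pow_lt {A : Finset Plane} (hA : IsGeneric A) {z : Plane}
    (hz : z ∈ convexHull ℝ (A : Set Plane)) {u v w : Plane} (hu : u ∈ A) (hv : v ∈ A) (hw : w ∈ A)
    (h : 0 < orient u v w) (hD : ∀ y ∈ A, 0 ≤ pow u v w y) (hneg : orient u v z < 0) :
    ∃ a ∈ A, ∃ b ∈ A, ∃ c ∈ A, 0 < orient a b c ∧ (∀ y ∈ A, 0 ≤ pow a b c y) ∧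
      pow a b c z < pow u v w z := by
  have hz' : 0 < orient v u z := by
    rw [orient_swap]
    linarith
  obtain ⟨a, ha, hapos⟩ := exists_orient_pos hz hz'
  obtain ⟨s, hs, hspos, hs0⟩ := exists_empty_circle (A := A) (u := v) (v := u)
    (k := dotAt v u w / orient v u w) (fun y hy => by
      have h0 := hD y hy
      rwa [← pow_swap] at h0) ha hapos
  refine ⟨v, hv, u, hu, s, hs, hspos, hs0, pow_lt_pow hspos hz' ?_⟩
  -- Strictness comes from genericity: s would otherwise be a fourth cocircular point.
  refine lt_of_le_of_ne (hD s hs) fun h0 => ?_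
  have hm := hA.mem_of_pow_eq_zero hu hv hw hs h h0.symm
  simp only [Finset.mem_insert, Finset.mem_singleton] at hm
  rcases hm with rfl | rfl | rfl
  · simp at hspos
  · simp at hspos
  · rw [orient_swap] at hspos
    linarith

theorem orient_neg_of_notMem {u v w z : Plane} (h : 0 < orient u v w)
    (hz : z ∉ convexHull ℝ ({u, v, w} : Set Plane)) :
    orient u v z < 0 ∨ orient v w z < 0 ∨ orient w u z < 0 := by
  by_contra! hcon
  exact hz ((mem_triangle_iff h).2 hcon)

/-- Among the Delaunay triangles, one minimizing the power of z contains z; otherwise crossing an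
edge that separates it from z lowers the power. -/
theorem isPureCover_delaunay {A : Finset Plane} (hA : IsGeneric A) (hcard : 3 ≤ A.card) :
    IsPureCover A (delaunay A) where
  toIsPure := isPure_delaunay hA
  cover := by
    classical
    intro z hz
    obtain ⟨a, ha, b, hb, c, hc, hpos, hD⟩ := exists_delaunay hA hcard
    obtain ⟨⟨u, v, w⟩, ht, hmin⟩ := ((A ×ˢ A ×ˢ A).filter fun t : Plane × Plane × Plane =>
      0 < orient t.1 t.2.1 t.2.2 ∧ ∀ y ∈ A, 0 ≤ pow t.1 t.2.1 t.2.2 y).exists_min_image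
      (fun t => pow t.1 t.2.1 t.2.2 z) ⟨(a, b, c), by simp [ha, hb, hc, hpos]; exact hD⟩
    simp only [Finset.mem_filter, Finset.mem_product, Prod.forall] at ht hmin
    obtain ⟨⟨hu, hv, hw⟩, huvw, hE⟩ := ht
    have hmin' : ∀ a ∈ A, ∀ b ∈ A, ∀ c ∈ A, 0 < orient a b c → (∀ y ∈ A, 0 ≤ pow a b c y) →
        ¬ pow a b c z < pow u v w z := fun a ha b hb c hc h1 h2 =>
      not_lt.2 (hmin a b c ⟨⟨ha, hb, hc⟩, h1, h2⟩)
    have e1 : ∀ y, pow v w u y = pow u v w y := fun y => pow_rotate y huvw.ne'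
    have e2 : ∀ y, pow w u v y = pow u v w y := fun y => by
      rw [pow_rotate y (by rw [orient_rotate]; exact huvw.ne'), e1]
    have hz' : z ∈ convexHull ℝ ({u, v, w} : Set Plane) := by
      by_contra hn
      rcases orient_neg_of_notMem huvw hn with h | h | h
      · obtain ⟨a, ha, b, hb, c, hc, h1, h2, h3⟩ :=
          exists_delaunay_pow_lt hA hz hu hv hw huvw hE h
        exact hmin' a ha b hb c hc h1 h2 h3
      · obtain ⟨a, ha, b, hb, c, hc, h1, h2, h3⟩ := exists_delaunay_pow_lt hA hz hv hw hu
          (by rwa [orient_rotate]) (fun y hy => by rw [e1]; exact hE y hy) h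
        exact hmin' a ha b hb c hc h1 h2 (by rwa [e1] at h3)
      · obtain ⟨a, ha, b, hb, c, hc, h1, h2, h3⟩ := exists_delaunay_pow_lt hA hz hw hu hv
          (by rwa [orient_rotate']) (fun y hy => by rw [e2]; exact hE y hy) h
        exact hmin' a ha b hb c hc h1 h2 (by rwa [e2] at h3)
    simp only [Set.mem_iUnion]
    exact ⟨{u, v, w}, (delaunay_iff hu hv hw huvw).2 hE, by simpa using hz'⟩

theorem pow_sub_pow_affine (a b c a' b' c' : Plane) :
    ∃ k l m : ℝ, ∀ y, pow a' b' c' y - pow a b c y = k + l * y 0 + m * y 1 := by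
  obtain ⟨o, ho⟩ := exists_pow_eq a b c
  obtain ⟨o', ho'⟩ := exists_pow_eq a' b' c'
  refine ⟨o' 0 ^ 2 + o' 1 ^ 2 - dist a' o' ^ 2 - (o 0 ^ 2 + o 1 ^ 2 - dist a o ^ 2),
    2 * (o 0 - o' 0), 2 * (o 1 - o' 1), fun y => ?_⟩
  rw [ho, ho', dist_sq y, dist_sq y]
  ring

theorem affine_barycentric (k l m : ℝ) (a b c z : Plane) :
    (k + l * z 0 + m * z 1) * orient a b c = orient b c z * (k + l * a 0 + m * a 1) +
      orient c a z * (k + l * b 0 + m * b 1) + orient a b z * (k + l * c 0 + m * c 1) := by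
  unfold orient; ring

/-- Two Delaunay triangles with overlapping interiors are equal. -/
theorem delaunay_subset_of_overlap {A : Finset Plane} (hA : IsGeneric A) {a b c z : Plane}
    {T : Finset Plane} (hD : {a, b, c} ∈ delaunay A) (hT : T ∈ delaunay A)
    (h : 0 < orient a b c) (h1 : 0 < orient a b z) (h2 : 0 < orient b c z) (h3 : 0 < orient c a z)
    (hz : z ∈ convexHull ℝ (T : Set Plane)) : {a, b, c} = T := by
  obtain ⟨a', b', c', rfl, ha', hb', hc', h'⟩ := exists_ccw hA hT.1 hT.2.1
  have ha : a ∈ A := hD.1 (by simp)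
  have hb : b ∈ A := hD.1 (by simp)
  have hc : c ∈ A := hD.1 (by simp)
  have hE := (delaunay_iff ha hb hc h).1 hD
  have hE' := (delaunay_iff ha' hb' hc' h').1 hT
  -- The affine difference of the powers is nonnegative at a, b, c and nonpositive at a', b', c'. As
  -- z lies in both triangles, it vanishes at z, and positive weights make it vanish at a, b, c.
  obtain ⟨k, l, m, hk⟩ := pow_sub_pow_affine a b c a' b' c'
  have i1 := affine_barycentric k l m a b c z
  have i2 := affine_barycentric k l m a' b' c' z
  rw [← hk, ← hk, ← hk, ← hk, pow_left, pow_mid, pow_right h.ne'] at i1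
  rw [← hk, ← hk, ← hk, ← hk, pow_left a', pow_mid a', pow_right h'.ne'] at i2
  obtain ⟨j1, j2, j3⟩ := (mem_triangle_iff h').1 (by simpa using hz)
  have n1 : pow a' b' c' z - pow a b c z ≤ 0 := by
    by_contra! hcon
    have := mul_pos hcon h'
    linarith [mul_nonneg j1 (hE c' hc'), mul_nonneg j2 (hE a' ha'), mul_nonneg j3 (hE b' hb')]
  have n2 := mul_nonneg (neg_nonneg.2 n1) h.le
  have ma := mul_nonneg h2.le (hE' a ha)
  have mb := mul_nonneg h3.le (hE' b hb)
  have mc := mul_nonneg h1.le (hE' c hc)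
  have za : pow a' b' c' a = 0 := by
    have : orient b c z * pow a' b' c' a = 0 := by linarith
    simpa [h2.ne'] using this
  have zb : pow a' b' c' b = 0 := by
    have : orient c a z * pow a' b' c' b = 0 := by linarith
    simpa [h3.ne'] using this
  have zc : pow a' b' c' c = 0 := by
    have : orient a b z * pow a' b' c' c = 0 := by linarith
    simpa [h1.ne'] using this
  refine Finset.eq_of_subset_of_card_le ?_ (by rw [hT.2.1, hD.2.1])
  rw [Finset.insert_subset_iff, Finset.insert_subset_iff, Finset.singleton_subset_iff]
  exact ⟨hA.mem_of_pow_eq_zero ha' hb' hc' ha h' za, hA.mem_of_pow_eq_zero ha' hb' hc' hb h' zb,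
    hA.mem_of_pow_eq_zero ha' hb' hc' hc h' zc⟩

/-! ### Circumcircles of the white triangles of the Delaunay triangulation -/

/-- Two angles sum to at most π exactly when their cotangents have nonnegative sum, and this sum is
the coefficient in `pow_sub_pow`. -/
theorem pow_nonneg_of_angle_add_le {u v w p : Plane} (hw : 0 < orient v u w)
    (hp : 0 < orient u v p)
    (h : EuclideanGeometry.angle v w u + EuclideanGeometry.angle u p v ≤ Real.pi) :
    0 ≤ pow v u w p := by
  rw [angle_eq_arctan hw, angle_eq_arctan hp] at h
  have h1 : Real.arctan (-(dotAt v u w / orient v u w)) ≤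
      Real.arctan (dotAt u v p / orient u v p) := by
    rw [Real.arctan_neg]
    linarith
  rw [Real.arctan_strictMono.le_iff_le] at h1
  have h2 := pow_sub_pow u v p w p
  rw [pow_right hp.ne', sub_zero] at h2
  rw [h2]
  exact mul_nonneg (by linarith) hp.le

theorem mem_of_overlap {C : Set (Finset Plane)} {R V : Set Plane} (hC : IsSubdivision R V C)
    {u v w p q : Plane} (hT : {v, u, w} ∈ C) (hw : 0 < orient v u w) (hT' : {u, p, q} ∈ C)
    (hc : Crosses u v p q) : q = v := by
  rcases hc.below with h | h
  · exact h
  exfalso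
  -- With third argument u the germ runs straight along the edge uv. It would be interior to upq,
  -- yet edge-to-edge would confine it to the segment uw.
  obtain ⟨ε, ⟨h1, h2, h3⟩, h4, h5⟩ := ((hc.orient_germ_pos (w := u) (Or.inr h)).and
    ((germ_eventually_mem_hull u v u).and eventually_pos)).exists
  have hm : germ u v u ε ∈ convexHull ℝ (((({v, u, w} : Finset Plane)) : Set Plane) ∩
      ((({u, p, q} : Finset Plane)) : Set Plane)) := by
    rw [← hC.edge_to_edge _ hT _ hT']
    constructor
    · refine convexHull_mono ?_ h4
      rintro y (rfl | rfl | rfl) <;> simp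
    · simp only [Finset.coe_insert, Finset.coe_singleton]
      rw [Set.pair_comm p q]
      exact (mem_triangle_iff hc.pos).2 ⟨h1.le, h2.le, h3.le⟩
  have habove := hc.above
  have hm' : germ u v u ε ∈ convexHull ℝ ({u, w} : Set Plane) := by
    refine convexHull_mono ?_ hm
    rintro y ⟨hy, hy'⟩
    have : y ≠ v := by
      rintro rfl
      simp only [Finset.coe_insert, Finset.coe_singleton, Set.mem_insert_iff,
        Set.mem_singleton_iff] at hy'
      rcases hy' with rfl | rfl | rfl
      · simp at hw
      · simp at habove
      · simp at h
    simp only [Finset.coe_insert, Finset.coe_singleton, Set.mem_insert_iff,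
      Set.mem_singleton_iff] at hy ⊢
    tauto
  have h0 := orient_eq_zero_of_mem_segment hm'
  rw [← orient_rotate, orient_germ] at h0
  simp only [orient_self_outer, mul_zero, zero_add, add_zero] at h0
  rw [orient_rotate' v u w |>.symm.trans (orient_rotate' _ _ _).symm] at hw
  have := mul_pos h5 hw
  linarith

/-- One step of the descent: cross the edge uv towards a. The Delaunay triangle met there decides
whether the white region continues beyond uv. -/
theorem exists_pow_lt_of_white {A : Finset Plane} (hA : IsGeneric A) (hcard : 3 ≤ A.card)
    {x : Plane} {W : Set (Finset Plane)}
    (hW : IsConstrainedDelaunay (whiteRegion A (delaunay A) x) (neighbors (delaunay A) x) W)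
    {u v w a : Plane} (hT : {v, u, w} ∈ W) (hw : 0 < orient v u w) (ha : a ∈ A) (hax : a ≠ x)
    (hneg : pow v u w a < 0) (hside : orient v u a < 0) :
    ∃ a' b' c', {a', b', c'} ∈ W ∧ 0 < orient a' b' c' ∧ pow a' b' c' a < pow v u w a := by
  have hcov := isPureCover_delaunay hA hcard
  have hWp := hcov.toIsPure.white hA hW
  have haB : a ∈ A.erase x := Finset.mem_erase.2 ⟨hax, ha⟩
  have huB : u ∈ A.erase x := hWp.subset _ hT (by simp)
  have hvB : v ∈ A.erase x := hWp.subset _ hT (by simp)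
  have hwB : w ∈ A.erase x := hWp.subset _ hT (by simp)
  have huA := Finset.mem_of_mem_erase huB
  have hvA := Finset.mem_of_mem_erase hvB
  have hwA := Finset.mem_of_mem_erase hwB
  have hpos : 0 < orient u v a := by
    rw [orient_swap]
    linarith
  obtain ⟨p, q, hpq, hc⟩ := hcov.toIsPure.exists_crosses hA subset_rfl huA hvA hpos (by
    refine Eventually.frequently ?_
    filter_upwards [germ_eventually_mem_interior hpos] with ε hε
    refine hcov.cover (convexHull_mono ?_ (interior_subset hε))
    rintro y (rfl | rfl | rfl)
    exacts [huA, hvA, ha])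
  by_cases hx : x ∈ ({u, p, q} : Finset Plane)
  · obtain ⟨p', q', hT', hc'⟩ := hcov.toIsPure.exists_crosses_white hA hW huB hvB haB hpos hpq hx hc
    obtain rfl := mem_of_overlap hW.1 hT hw hT' hc'
    have hp' := hc'.above
    have hp'A : p' ∈ A := Finset.mem_of_mem_erase (hWp.subset _ hT' (by simp))
    have huv : u ≠ q' := by
      rintro rfl
      simp at hw
    have hpw : p' ∉ ({q', u, w} : Finset Plane) := by
      simp only [Finset.mem_insert, Finset.mem_singleton, not_or]
      refine ⟨?_, ?_, ?_⟩ <;> rintro rfl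
      · simp at hp'
      · simp at hp'
      · rw [orient_swap] at hw
        linarith
    have hwp : w ∉ ({u, p', q'} : Finset Plane) := by
      simp only [Finset.mem_insert, Finset.mem_singleton, not_or]
      refine ⟨?_, ?_, ?_⟩ <;> rintro rfl
      · simp at hw
      · simp at hpw
      · simp at hw
    have hang := hW.2 _ hT _ hT' u q' w p' huv (by simp) (by simp) (by simp) (by simp)
      (by simp) hwp (by simp) hpw
    rw [EuclideanGeometry.angle_comm u w q'] at hang
    have h0 := pow_nonneg_of_angle_add_le hw hp' hang
    refine ⟨u, q', p', by rwa [Finset.pair_comm] at hT', hp',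
      pow_lt_pow hp' hpos (lt_of_le_of_ne h0 fun h1 => hpw ?_)⟩
    exact hA.mem_of_pow_eq_zero hvA huA hwA hp'A hw h1.symm
  · exfalso
    rcases hc.below with rfl | hq
    -- Here uvp is Delaunay and w is not inside its circle, so a, lying beyond uv and inside the
    -- circle of vuw, would be inside the circle of uvp too.
    · rw [Finset.pair_comm] at hpq
      have hpA : p ∈ A := hpq.1 (by simp)
      have hD := (delaunay_iff huA hvA hpA hc.above).1 hpq
      have := pow_le_pow hw hpos (hD w hwA)
      linarith [hD a ha]
    -- Here pq crosses uv, so a germ on the side of w is interior to a Delaunay triangle without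
    -- vertex x and also lies in the star of x: an overlap.
    · obtain ⟨ε, ⟨h1, h2, h3⟩, h4⟩ := ((hc.orient_germ_pos (w := w) (Or.inr hq)).and
        (germ_eventually_mem_hull u v w)).exists
      have hs : germ u v w ε ∈ star (delaunay A) x := by
        have m1 : germ u v w ε ∈ closure (interior (whiteRegion A (delaunay A) x)) := by
          rw [← hW.1.cover]
          simp only [Set.mem_iUnion]
          refine ⟨_, hT, convexHull_mono ?_ h4⟩
          rintro y (rfl | rfl | rfl) <;> simp
        exact closure_minimal (interior_subset.trans Set.inter_subset_left)
          (isClosed_star hcov.subset x) m1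
      simp only [star, Set.mem_iUnion] at hs
      obtain ⟨T, ⟨hTD, hxT⟩, hm⟩ := hs
      rw [Finset.pair_comm] at hpq hx
      rw [delaunay_subset_of_overlap hA hpq hTD hc.pos h1 h2 h3 hm] at hx
      exact hx hxT

theorem pow_nonneg_of_white {A : Finset Plane} (hA : IsGeneric A) (hcard : 3 ≤ A.card)
    {x : Plane} {W : Set (Finset Plane)}
    (hW : IsConstrainedDelaunay (whiteRegion A (delaunay A) x) (neighbors (delaunay A) x) W)
    {u v w a : Plane} (hT : {u, v, w} ∈ W) (hpos : 0 < orient u v w) (ha : a ∈ A) (hax : a ≠ x) :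
    0 ≤ pow u v w a := by
  classical
  by_contra! hneg
  have hWp := (isPureCover_delaunay hA hcard).toIsPure.white hA hW
  have hmem : ∀ {a b c : Plane}, {a, b, c} ∈ W → a ∈ A ∧ b ∈ A ∧ c ∈ A := fun h =>
    ⟨Finset.mem_of_mem_erase (hWp.subset _ h (by simp)),
      Finset.mem_of_mem_erase (hWp.subset _ h (by simp)),
      Finset.mem_of_mem_erase (hWp.subset _ h (by simp))⟩
  obtain ⟨⟨b, c, d⟩, ht, hmin⟩ := ((A ×ˢ A ×ˢ A).filter fun t : Plane × Plane × Plane =>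
    {t.1, t.2.1, t.2.2} ∈ W ∧ 0 < orient t.1 t.2.1 t.2.2).exists_min_image
    (fun t => pow t.1 t.2.1 t.2.2 a) ⟨(u, v, w), by simp [hmem hT, hpos, hT]⟩
  simp only [Finset.mem_filter, Finset.mem_product, Prod.forall] at ht hmin
  obtain ⟨-, hbcd, hpos'⟩ := ht
  have hneg' : pow b c d a < 0 :=
    (hmin u v w ⟨hmem hT, hT, hpos⟩).trans_lt hneg
  have hcon : ∀ {a' b' c' : Plane}, {a', b', c'} ∈ W → 0 < orient a' b' c' →
      ¬ pow a' b' c' a < pow b c d a := fun h1 h2 =>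
    not_lt.2 (hmin _ _ _ ⟨hmem h1, h1, h2⟩)
  have e1 : pow c d b a = pow b c d a := pow_rotate a hpos'.ne'
  have e2 : pow d b c a = pow b c d a := by
    rw [pow_rotate a (by rw [orient_rotate]; exact hpos'.ne'), e1]
  have hn : a ∉ convexHull ℝ ({b, c, d} : Set Plane) := by
    intro h
    have := hWp.vertex _ hbcd a (Finset.mem_erase.2 ⟨hax, ha⟩) (by simpa using h)
    simp only [Finset.mem_insert, Finset.mem_singleton] at this
    rcases this with rfl | rfl | rfl
    · exact hneg'.ne (pow_left _ _ _)
    · exact hneg'.ne (pow_mid _ _ _)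
    · exact hneg'.ne (pow_right hpos'.ne')
  rcases orient_neg_of_notMem hpos' hn with h | h | h
  · obtain ⟨_, _, _, h1, h2, h3⟩ := exists_pow_lt_of_white hA hcard hW hbcd hpos' ha hax hneg' h
    exact hcon h1 h2 h3
  · obtain ⟨_, _, _, h1, h2, h3⟩ := exists_pow_lt_of_white hA hcard hW (v := c) (u := d) (w := b)
      (by convert hbcd using 1; ext; simp; tauto) (by rwa [orient_rotate]) ha hax
      (by rwa [e1]) h
    exact hcon h1 h2 (by rwa [e1] at h3)
  · obtain ⟨_, _, _, h1, h2, h3⟩ := exists_pow_lt_of_white hA hcard hW (v := d) (u := b) (w := c)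
      (by convert hbcd using 1; ext; simp; tauto) (by rwa [orient_rotate']) ha hax
      (by rwa [e2]) h
    exact hcon h1 h2 (by rwa [e2] at h3)

/-! ### Conclusion -/

theorem IsAged.subset {A : Finset Plane} (hA : IsGeneric A) {P Φ : Set (Finset Plane)}
    (hP : IsPure A P) (hΦ : IsAged A P Φ) : ∀ T ∈ Φ, T ⊆ A ∧ T.card = 3 := by
  obtain ⟨W, hW, rfl⟩ := hΦ
  rintro T (hT | hT)
  · exact ⟨hP.subset T hT, hP.card T hT⟩
  · simp only [Set.mem_iUnion] at hT
    obtain ⟨x, hx, hT⟩ := hT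
    have := hP.white hA (hW x hx)
    exact ⟨(this.subset T hT).trans (Finset.erase_subset _ _), this.card T hT⟩

theorem eq_of_pow_neg {A : Finset Plane} (hA : IsGeneric A) (hcard : 3 ≤ A.card)
    {Δ : Set (Finset Plane)} (hΔ : IsAged A (delaunay A) Δ) {u v w : Plane}
    (hT : {u, v, w} ∈ Δ) (hpos : 0 < orient u v w) :
    ∀ y ∈ A, ∀ y' ∈ A, pow u v w y < 0 → pow u v w y' < 0 → y = y' := by
  have hsub := (hΔ.subset hA (isPure_delaunay hA) _ hT).1
  obtain ⟨W, hW, rfl⟩ := hΔ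
  intro y hy y' hy' h h'
  rcases hT with hT | hT
  · exact absurd h (not_lt.2 ((delaunay_iff (hsub (by simp)) (hsub (by simp)) (hsub (by simp))
      hpos).1 hT y hy))
  · simp only [Set.mem_iUnion] at hT
    obtain ⟨x, hx, hT⟩ := hT
    have key : ∀ z ∈ A, pow u v w z < 0 → z = x := by
      intro z hz hlt
      by_contra hzx
      exact absurd hlt (not_lt.2 (pow_nonneg_of_white hA hcard (hW x hx) hT hpos hz hzx))
    rw [key y hy h, key y' hy' h']

theorem finite_angles {A : Finset Plane} {Φ : Set (Finset Plane)} (h : ∀ T ∈ Φ, T ⊆ A) :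
    (angles Φ).Finite := by
  refine (((A ×ˢ A ×ˢ A).finite_toSet).image
    fun t : Plane × Plane × Plane => EuclideanGeometry.angle t.1 t.2.1 t.2.2).subset ?_
  rintro θ ⟨T, hT, a, ha, b, hb, c, hc, -, -, -, rfl⟩
  exact ⟨(a, b, c), by simp [h T hT ha, h T hT hb, h T hT hc], rfl⟩

theorem exists_isLeast {s : Set ℝ} (hs : s.Finite) (hne : s.Nonempty) : ∃ m, IsLeast s m := by
  obtain ⟨m, hm, h⟩ := Set.exists_min_image s id hs hne
  exact ⟨m, hm, h⟩

end HyperTri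

theorem mainTheorem5 (A : Finset HyperTri.Plane) (hcard : 3 ≤ A.card)
    (hA : HyperTri.IsGeneric A)
    (P : Set (Finset HyperTri.Plane)) (hP : HyperTri.IsCompleteTriangulation A P)
    (Φ Δ : Set (Finset HyperTri.Plane))
    (hΦ : HyperTri.IsAged A P Φ)
    (hΔ : HyperTri.IsAged A (HyperTri.delaunay A) Δ) :
    ∃ φ δ : ℝ, IsLeast (HyperTri.angles Φ) φ ∧ IsLeast (HyperTri.angles Δ) δ ∧ φ ≤ δ := by
  open HyperTri in
  have hPc := hP.isPureCover hA
  have hΦs := hΦ.subset hA hPc.toIsPure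
  have hΔs := hΔ.subset hA (isPure_delaunay hA)
  have key : ∀ δ ∈ angles Δ, ∃ φ ∈ angles Φ, φ ≤ δ := by
    rintro δ ⟨T, hT, a, ha, b, hb, c, hc, hab, hbc, hac, rfl⟩
    obtain ⟨hTA, hT3⟩ := hΔs T hT
    -- The apex b goes last, to match the angle opposite to the edge ac.
    have hTe : T = {a, c, b} := by
      refine (Finset.eq_of_subset_of_card_le ?_ ?_).symm
      · simp [Finset.insert_subset_iff, ha, hb, hc]
      · rw [hT3, Finset.card_eq_three.2 ⟨a, c, b, hac, hab, hbc.symm, rfl⟩]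
    subst hTe
    rcases lt_or_gt_of_ne (hA.orient_ne_zero (hTA ha) (hTA hc) (hTA hb) hac hbc.symm hab) with h | h
    · rw [EuclideanGeometry.angle_comm]
      have hpos : 0 < orient c a b := by
        rw [orient_swap]
        linarith
      exact exists_angle_le hA hPc hΦ (hTA hc) (hTA ha) (hTA hb) hpos
        (eq_of_pow_neg hA hcard hΔ (by rwa [Finset.insert_comm]) hpos)
    · exact exists_angle_le hA hPc hΦ (hTA ha) (hTA hc) (hTA hb) h
        (eq_of_pow_neg hA hcard hΔ hT h)
  have hΔne : (angles Δ).Nonempty := by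
    obtain ⟨a, ha, b, hb, c, hc, hpos, hD⟩ := exists_delaunay hA hcard
    have hT : {a, b, c} ∈ Δ := by
      obtain ⟨W, -, rfl⟩ := hΔ
      exact Or.inl ((delaunay_iff ha hb hc hpos).2 hD)
    refine ⟨_, _, hT, a, by simp, b, by simp, c, by simp, ?_, ?_, ?_, rfl⟩ <;> rintro rfl <;>
      simp at hpos
  obtain ⟨δ, hδ⟩ := exists_isLeast (finite_angles fun T hT => (hΔs T hT).1) hΔne
  obtain ⟨φ₀, hφ₀, hle⟩ := key δ hδ.1
  obtain ⟨φ, hφ⟩ := exists_isLeast (finite_angles fun T hT => (hΦs T hT).1) ⟨φ₀, hφ₀⟩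
  exact ⟨φ, δ, hφ, hδ, (hφ.2 hφ₀).trans hle⟩
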